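/- Let $N\ge 2$ be an integer. For an integer $w$ let $M_w(\Gamma_0(N))$ be the space of holomorphic modular forms of weight $w$ for $\Gamma_0(N)$, let $d_w(N)$ be its dimension, and for a form $f$ let $\nu(f)$ be its order of vanishing at $i\infty$ (the order of its expansion in powers of $q=e^{2\pi i\tau}$). A form is *unitary* if the first nonzero coefficient of its $q$-expansion is $1$; a *unitary upper triangular basis* of $M_w(\Gamma_0(N))$ is a basis $(E_{w,N}^{(s)})_{0\le s<d_w(N)}$ of unitary forms with $\nu(E_{w,N}^{(0)})<\nu(E_{w,N}^{(1)})<\cdots$. A *strong modular unit* of level $N$ and weight $w$ is a form in $M_w(\Gamma_0(N))$ that has no zero in the upper half-plane and does not vanish at any cusp inequivalent to $\infty$ under $\Gamma_0(N)$. Let $\Delta_N$ be a strong modular unit of level $N$ and of even weight $\rho_N>0$, let $(E_{\rho_N,N}^{(s)})_s$ and $(E_{2,N}^{(s)})_s$ be unitary upper triangular bases of $M_{\rho_N}(\Gamma_0(N))$ and $M_2(\Gamma_0(N))$, and suppose that $$d_{\rho_N}(N)=\nu(\Delta_N)+1 .$$ Then for every integer $k\ge \rho_N/2$ $$M_{2k}(\Gamma_0(N))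 = \Delta_N\cdot M_{2k-\rho_N}(\Gamma_0(N)) \oplus \operatorname{span}\left\{E_{\rho_N,N}^{(s)}\,\bigl(E_{2,N}^{(0)}\bigr)^{k-\rho_N/2} : 0\le s<\nu(\Delta_N)\right\}.$$ Moreover, if $k = q\frac{\rho_N}{2}+r$ with integers $q\ge 0$ and $1\le r\le \frac{\rho_N}{2}$, then $$M_{2k}(\Gamma_0(N)) = \Delta_N^{q}\cdot M_{2r}(\Gamma_0(N)) \oplus \bigoplus_{n=0}^{q-1} \Delta_N^{n}\cdot \operatorname{span}\left\{E_{\rho_N,N}^{(s)}\,\bigl(E_{2,N}^{(0)}\bigr)^{k-(n+1)\rho_N/2} : 0\le s<\nu(\Delta_N)\right\}.$$ -/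

import Mathlib

open UpperHalfPlane
open scoped MatrixGroups

noncomputable section

namespace StrongUnit

/-- The congruence subgroup `Γ₀(N)`, viewed in `GL(2, ℝ)`. -/
abbrev Γ₀ (N : ℕ) : Subgroup (GL (Fin 2) ℝ) :=
  (CongruenceSubgroup.Gamma0 N).map (Matrix.SpecialLinearGroup.mapGL ℝ)

/-- `M_w(Γ₀(N))`, the space of (holomorphic) modular forms of weight `w` for `Γ₀(N)`,
as a space of functions on the upper half-plane. -/
def M (N : ℕ) (w : ℤ) : Submodule ℂ (ℍ → ℂ) where
  carrier := {f | ∃ g : ModularForm (Γ₀ N) w, ⇑g = f}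
  add_mem' := by
    rintro _ _ ⟨f, rfl⟩ ⟨g, rfl⟩
    exact ⟨f + g, rfl⟩
  zero_mem' := ⟨0, rfl⟩
  smul_mem' := by
    rintro c _ ⟨f, rfl⟩
    exact ⟨c • f, rfl⟩

/-- `d_w(N)`, the dimension of `M_w(Γ₀(N))`. -/
def d (N : ℕ) (w : ℤ) : ℕ := Module.finrank ℂ (M N w)

/-- The valuation `ν(f)`: the order of vanishing at `i∞`, that is, the order of the expansion
of `f` in powers of `q = exp(2πiτ)` (it is `⊤` for `f = 0`). -/
def ν (f : ℍ → ℂ) : ℕ∞ := (qExpansion 1 f).order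

/-- A form is unitary if the first nonzero coefficient of its `q`-expansion is `1`. -/
def IsUnitary (f : ℍ → ℂ) : Prop :=
  (qExpansion 1 f).coeff (qExpansion 1 f).order.toNat = 1

/-- A strong modular unit of level `N` and weight `w`: a modular form of weight `w` for `Γ₀(N)`
without zeros in the upper half-plane, that vanishes at no cusp inequivalent to `∞`
under `Γ₀(N)`. -/
structure IsStrongModularUnit (N : ℕ) (w : ℤ) (f : ℍ → ℂ) : Prop where
  mem : f ∈ M N w
  ne_zero : ∀ τ : ℍ, f τ ≠ 0
  not_isZeroAt : ∀ c : OnePoint ℝ, IsCusp c (Γ₀ N) →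
    c ∉ MulAction.orbit (Γ₀ N) (OnePoint.infty : OnePoint ℝ) → ¬ c.IsZeroAt f w

/-- The forms `E s`, `0 ≤ s < d_w(N)`, are a unitary upper triangular basis of `M_w(Γ₀(N))`:
a basis of unitary forms with strictly increasing valuations. (The values `E s` with
`d_w(N) ≤ s` play no role.) -/
structure IsUnitaryTriangularBasis (N : ℕ) (w : ℤ) (E : ℕ → ℍ → ℂ) : Prop where
  linearIndepOn : LinearIndepOn ℂ E (Set.Iio (d N w))
  span_eq : Submodule.span ℂ (E '' Set.Iio (d N w)) = M N w
  isUnitary : ∀ s, s < d N w → IsUnitary (E s)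
  ν_lt : ∀ s t, s < t → t < d N w → ν (E s) < ν (E t)

/-- The space `g · W` of all products `g · f` with `f ∈ W`. -/
def mulSpace (g : ℍ → ℂ) (W : Submodule ℂ (ℍ → ℂ)) : Submodule ℂ (ℍ → ℂ) :=
  W.map (LinearMap.mulLeft ℂ g)

/-- `Vect (E s * F ^ e | 0 ≤ s < ν(Δ))`. -/
def piece (Δ : ℍ → ℂ) (E : ℕ → ℍ → ℂ) (F : ℍ → ℂ) (e : ℕ) : Submodule ℂ (ℍ → ℂ) :=
  Submodule.span ℂ ((fun s : ℕ => E s * F ^ e) '' {s : ℕ | (s : ℕ∞) < ν Δ})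

/-- `W` is the internal direct sum of the subspaces `A i`. -/
def IsInternalDirectSum {ι : Type} (W : Submodule ℂ (ℍ → ℂ))
    (A : ι → Submodule ℂ (ℍ → ℂ)) : Prop :=
  iSupIndep A ∧ ⨆ i, A i = W

end StrongUnit

end

/-! ### A weight 2 Eisenstein series that does not vanish at `i∞`. -/

noncomputable section

namespace StrongUnit

open Filter Topology Matrix.SpecialLinearGroup Complex EisensteinSeries
open scoped ModularForm Manifold Real

/-! Let `m = ν Δ`. Since `Δ` can vanish only at cusps equivalent to `∞`, a form `f` with `ν f ≥ m`
has a holomorphic quotient `f / Δ` (`div_mem_M`). Hence `Δ · M_{2k-ρ}` is exactly the set of forms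
of weight `2k` with valuation at least `m`, and any `m` forms of valuations `0, …, m - 1` span a
complement: their first `m` coefficients form an invertible triangular matrix
(`existsUnique_sub_order_ge`).

Such forms come from weight `ρ`. There a quotient by `Δ` of a form with valuation at least `m` has
weight 0, so is constant; nonzero forms thus have valuation at most `m`, and the `m + 1` increasing
valuations of the basis must be `0, …, m`. Multiplying by powers of `E₂ 0` reaches weight `2k`
without changing valuations, because `E₂ 0` does not vanish at `∞`: `N E₂(Nτ) - E₂(τ)` lies in `M_2`
and has constant term `N - 1 ≠ 0`. Iterating this one-step splitting gives the second decomposition.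
-/

/-- The matrix `diag(N, 1)` in `GL(2, K)`. -/
def diagGL (K : Type*) [Field K] (N : ℕ) (hN : (N : K) ≠ 0) : GL (Fin 2) K :=
  Matrix.GeneralLinearGroup.mkOfDetNeZero !![(N : K), 0; 0, 1] (by simpa using hN)

/-- `E₂` is one-periodic. -/
lemma periodic_E2 : Function.Periodic (E2 ∘ ofComplex) (1 : ℝ) := by
  intro w
  have hT : ∀ z : ℍ, E2 ((1 : ℝ) +ᵥ z) = E2 z := by
    intro z
    have h := congr_fun (E2_slash_action ModularGroup.T) z
    rw [ModularForm.SL_slash_apply, D2_T, UpperHalfPlane.modular_T_smul,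
      ModularGroup.denom_apply] at h
    simpa [ModularGroup.T] using h
  by_cases hw : 0 < w.im
  · have h1 : 0 < (w + (1 : ℝ)).im := by simpa using hw
    simp only [Function.comp_apply, ofComplex_apply_of_im_pos h1, ofComplex_apply_of_im_pos hw]
    rw [← hT ⟨w, hw⟩]
    congr 1
    ext
    simp [add_comm]
  · have h1 : (w + (1 : ℝ)).im ≤ 0 := by simpa using hw
    simp only [Function.comp_apply, ofComplex_apply_of_im_nonpos h1,
      ofComplex_apply_of_im_nonpos (not_lt.mp hw)]

/-- A periodic holomorphic function bounded at `i∞` tends to its constant coefficient. -/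
lemma tendsto_coeff_zero {h : ℝ} (hh : 0 < h) {f : ℍ → ℂ}
    (hper : Function.Periodic (f ∘ ofComplex) h) (hol : MDiff f) (hb : IsBoundedAtImInfty f) :
    Tendsto f atImInfty (𝓝 ((qExpansion h f).coeff 0)) := by
  have han := analyticAt_cuspFunction_zero hh hper hol hb
  have hcomp : (cuspFunction h f ∘ fun τ : ℍ ↦ Function.Periodic.qParam h τ) = f := by
    funext τ
    simpa using eq_cuspFunction τ hh.ne' hper
  have := han.continuousAt.tendsto.comp (qParam_tendsto_atImInfty hh)
  rw [hcomp] at this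
  simpa [qExpansion_coeff] using this

lemma tendsto_E2 : Tendsto E2 atImInfty (𝓝 1) := by
  have h := tendsto_coeff_zero one_pos periodic_E2 E2_mdifferentiable isBoundedAtImInfty_E2
  have h1 := (hasFPowerSeriesOnBall_cuspFunction
    (c := fun m => if m = 0 then 1 else -24 * (ArithmeticFunction.sigma 1 m : ℂ)) one_pos
    (analyticAt_cuspFunction_zero one_pos periodic_E2 E2_mdifferentiable isBoundedAtImInfty_E2)
    (fun τ => by
      simpa only [Function.Periodic.qParam, ofReal_one, div_one] using
        hasSum_qExpansion_E2 (z := τ))).coeff_zero (fun _ => 1)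
  rw [FormalMultilinearSeries.ofScalars_apply_eq] at h1
  simp only [if_true, pow_zero, smul_eq_mul, mul_one] at h1
  simpa [qExpansion_coeff, ← h1] using h

/-- `D2 γ z` is `2πi c / (cz + d)`, and `|cz + d| ≥ |c| Im z ≥ |c|` once `Im z ≥ 1`. -/
lemma isBoundedAtImInfty_D2 (γ : SL(2, ℤ)) : IsBoundedAtImInfty (D2 γ) := by
  rw [isBoundedAtImInfty_iff]
  refine ⟨2 * π, 1, fun z hz => ?_⟩
  by_cases hc : γ 1 0 = 0
  · simp [D2, hc]; positivity
  · have h1 : (1 : ℝ) ≤ |((γ 1 0 : ℤ) : ℝ)| := by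
      exact_mod_cast Int.one_le_abs hc
    have h2 : |((γ 1 0 : ℤ) : ℝ)| ≤ ‖denom γ z‖ := by
      have h3 := Complex.abs_im_le_norm (denom γ z)
      rw [ModularGroup.denom_apply] at h3 ⊢
      refine le_trans ?_ h3
      simp only [Complex.add_im, Complex.mul_im, Complex.intCast_re, Complex.intCast_im,
        zero_mul, add_zero, abs_mul]
      exact le_mul_of_one_le_right (abs_nonneg _) (hz.trans (le_abs_self _))
    rw [D2, norm_div, div_le_iff₀ (lt_of_lt_of_le (by positivity) h2)]
    simp only [norm_mul, Complex.norm_ofNat, Complex.norm_real, Real.norm_eq_abs,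
      abs_of_pos Real.pi_pos, Complex.norm_I, mul_one, Complex.norm_intCast]
    gcongr

lemma isBoundedAtImInfty_E2_slash_SL (γ : SL(2, ℤ)) : IsBoundedAtImInfty (E2 ∣[(2 : ℤ)] γ) := by
  rw [E2_slash_action]
  have h := isBoundedAtImInfty_E2.sub ((isBoundedAtImInfty_D2 γ).smul (1 / (2 * riemannZeta 2)))
  exact h

lemma map_mapGL_rat (γ : SL(2, ℤ)) : (mapGL ℚ γ).map (Rat.castHom ℝ) = mapGL ℝ γ := by
  ext i j
  simp

lemma sub_slash (k : ℤ) (g : GL (Fin 2) ℝ) (f₁ f₂ : ℍ → ℂ) :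
    (f₁ - f₂) ∣[k] g = f₁ ∣[k] g - f₂ ∣[k] g := by
  rw [sub_eq_add_neg, SlashAction.add_slash, SlashAction.neg_slash, ← sub_eq_add_neg]

lemma sub_slash_SL (k : ℤ) (γ : SL(2, ℤ)) (f₁ f₂ : ℍ → ℂ) :
    (f₁ - f₂) ∣[k] γ = f₁ ∣[k] γ - f₂ ∣[k] γ :=
  sub_slash k _ f₁ f₂

/-- Slashing `E₂` by a rational matrix gives a function bounded at `i∞`. -/
lemma isBoundedAtImInfty_E2_slash_rat (g : GL (Fin 2) ℚ) :
    IsBoundedAtImInfty (E2 ∣[(2 : ℤ)] (g.map (Rat.castHom ℝ))) := by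
  obtain ⟨γ, hγ⟩ := OnePoint.exists_mem_SL2 ℤ (g • (OnePoint.infty : OnePoint ℚ))
  have hγ' : (mapGL ℝ γ) • (OnePoint.infty : OnePoint ℝ) =
      (g.map (Rat.castHom ℝ)) • (OnePoint.infty : OnePoint ℝ) := by
    have := congr_arg (OnePoint.map (Rat.castHom ℝ)) hγ
    rwa [OnePoint.map_smul, OnePoint.map_smul, OnePoint.map_infty, map_mapGL_rat] at this
  -- `γ` sends `∞` to the same cusp as `g`, so `B` fixes `∞`, and slashing by it preserves
  -- boundedness.
  set B : GL (Fin 2) ℝ := (mapGL ℝ γ)⁻¹ * g.map (Rat.castHom ℝ) with hB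
  have hBinf : B • (OnePoint.infty : OnePoint ℝ) = OnePoint.infty := by
    rw [hB, mul_smul, ← hγ', inv_smul_smul]
  have hg : g.map (Rat.castHom ℝ) = mapGL ℝ γ * B := by rw [hB, mul_inv_cancel_left]
  rw [hg, SlashAction.slash_mul]
  exact (isBoundedAtImInfty_E2_slash_SL γ).slash _ (OnePoint.smul_infty_eq_self_iff.mp hBinf)

/-- The Eisenstein series `N E₂(Nτ) - E₂(τ)`. -/
def eisTwo (N : ℕ) (hN : (N : ℝ) ≠ 0) : ℍ → ℂ := E2 ∣[(2 : ℤ)] diagGL ℝ N hN - E2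

lemma diagGL_map (N : ℕ) (hQ : (N : ℚ) ≠ 0) (hR : (N : ℝ) ≠ 0) :
    (diagGL ℚ N hQ).map (Rat.castHom ℝ) = diagGL ℝ N hR := by
  ext i j
  fin_cases i <;> fin_cases j <;>
    simp [diagGL, Matrix.GeneralLinearGroup.mkOfDetNeZero]

/-- As `N` divides the lower left entry of `γ`, `diag(N, 1) γ = γ' diag(N, 1)` with `γ'` in `SL(2,
ℤ)`. Both terms then pick up the same anomaly `D2 γ`, which cancels. -/
lemma eisTwo_slash (N : ℕ) (hN : (N : ℝ) ≠ 0) {γ : SL(2, ℤ)}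
    (hγ : γ ∈ CongruenceSubgroup.Gamma0 N) : eisTwo N hN ∣[(2 : ℤ)] γ = eisTwo N hN := by
  obtain ⟨c, hc⟩ := (ZMod.intCast_zmod_eq_zero_iff_dvd (γ 1 0) N).mp
    (CongruenceSubgroup.Gamma0_mem.mp hγ)
  have hdet := Matrix.det_fin_two γ.1
  rw [γ.det_coe] at hdet
  obtain ⟨γ', h00, h01, h10, h11⟩ : ∃ γ' : SL(2, ℤ), γ' 0 0 = γ 0 0 ∧ γ' 0 1 = N * γ 0 1 ∧
      γ' 1 0 = c ∧ γ' 1 1 = γ 1 1 := by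
    refine ⟨⟨!![γ 0 0, N * γ 0 1; c, γ 1 1], ?_⟩, rfl, rfl, rfl, rfl⟩
    rw [hc] at hdet
    rw [Matrix.det_fin_two_of]
    linarith
  have hcomm : diagGL ℝ N hN * mapGL ℝ γ = mapGL ℝ γ' * diagGL ℝ N hN := by
    ext i j
    rw [Units.val_mul, Units.val_mul, mapGL_coe_matrix, mapGL_coe_matrix]
    fin_cases i <;> fin_cases j <;>
      simp [diagGL, Matrix.GeneralLinearGroup.mkOfDetNeZero, Matrix.mul_apply,
        Fin.sum_univ_two, hc, h00, h01, h10, h11, mul_comm]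
  have hdetA : (diagGL ℝ N hN).det.val = N := by
    simp [diagGL, Matrix.GeneralLinearGroup.mkOfDetNeZero]
  have hNpos : (0 : ℝ) < N := lt_of_le_of_ne (Nat.cast_nonneg _) hN.symm
  have hσ : σ (diagGL ℝ N hN) = ContinuousAlgEquiv.refl ℝ ℂ := by
    rw [σ, if_pos (by rw [hdetA]; exact hNpos)]
  have hD : D2 γ' ∣[(2 : ℤ)] diagGL ℝ N hN = D2 γ := by
    ext τ
    have hsm : ((diagGL ℝ N hN • τ : ℍ) : ℂ) = N * τ := by
      rw [UpperHalfPlane.coe_smul_of_det_pos (by rw [hdetA]; exact hNpos)]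
      simp [num, denom, diagGL, Matrix.GeneralLinearGroup.mkOfDetNeZero]
    rw [ModularForm.slash_apply, hσ, hdetA]
    simp only [D2, ModularGroup.denom_apply, hsm]
    have hd := UpperHalfPlane.denom_ne_zero γ τ
    rw [ModularGroup.denom_apply, hc] at hd
    have hN' : (N : ℂ) ≠ 0 := by exact_mod_cast hN
    simp [denom, diagGL, Matrix.GeneralLinearGroup.mkOfDetNeZero, hc, h10, h11] at hd ⊢
    field_simp
  have h1 : (E2 ∣[(2 : ℤ)] diagGL ℝ N hN) ∣[(2 : ℤ)] γ =
      E2 ∣[(2 : ℤ)] diagGL ℝ N hN - (1 / (2 * riemannZeta 2)) • D2 γ := by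
    rw [ModularForm.SL_slash]
    change (E2 ∣[(2 : ℤ)] diagGL ℝ N hN) ∣[(2 : ℤ)] (mapGL ℝ γ) = _
    rw [← SlashAction.slash_mul, hcomm, SlashAction.slash_mul]
    change (E2 ∣[(2 : ℤ)] γ') ∣[(2 : ℤ)] diagGL ℝ N hN = _
    rw [E2_slash_action, sub_slash, ModularForm.smul_slash, hD, hσ]
    rfl
  rw [eisTwo, sub_slash_SL, h1, E2_slash_action]
  abel

lemma eisTwo_mem (N : ℕ) [NeZero N] (hN : (N : ℝ) ≠ 0) : eisTwo N hN ∈ M N 2 := by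
  refine ⟨{ toFun := eisTwo N hN, slash_action_eq' := ?_, holo' := ?_, bdd_at_cusps' := ?_ }, rfl⟩
  · rintro _ ⟨γ, hγ, rfl⟩
    exact eisTwo_slash N hN hγ
  · exact (E2_mdifferentiable.slash _ _).sub E2_mdifferentiable
  · intro c hc
    rw [Subgroup.IsArithmetic.isCusp_iff_isCusp_SL2Z] at hc
    rw [OnePoint.isBoundedAt_iff_forall_SL2Z hc]
    intro γ _
    have hQ : (N : ℚ) ≠ 0 := by exact_mod_cast hN
    have h1 := isBoundedAtImInfty_E2_slash_rat (diagGL ℚ N hQ * mapGL ℚ γ)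
    have h2 : (diagGL ℚ N hQ * mapGL ℚ γ).map (Rat.castHom ℝ) =
        diagGL ℝ N hN * mapGL ℝ γ := by
      rw [map_mul, diagGL_map, map_mapGL_rat]
    rw [h2, SlashAction.slash_mul] at h1
    change IsBoundedAtImInfty (eisTwo N hN ∣[(2 : ℤ)] γ)
    rw [eisTwo, sub_slash_SL]
    exact h1.sub (isBoundedAtImInfty_E2_slash_SL γ)

lemma tendsto_eisTwo (N : ℕ) (hN : (N : ℝ) ≠ 0) :
    Tendsto (eisTwo N hN) atImInfty (𝓝 (N - 1)) := by
  refine Tendsto.sub ?_ tendsto_E2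
  have h := (tendsto_E2.comp (tendsto_smul_atImInfty (g := diagGL ℝ N hN)
    (by simp [diagGL, Matrix.GeneralLinearGroup.mkOfDetNeZero])))
  have hdetA : (diagGL ℝ N hN).det.val = N := by
    simp [diagGL, Matrix.GeneralLinearGroup.mkOfDetNeZero]
  have hNpos : (0 : ℝ) < N := lt_of_le_of_ne (Nat.cast_nonneg _) hN.symm
  have hσ : σ (diagGL ℝ N hN) = ContinuousAlgEquiv.refl ℝ ℂ := by
    rw [σ, if_pos (by rw [hdetA]; exact hNpos)]
  -- The factor `N` is `det ^ (k - 1)` for `k = 2`.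
  have h2 : E2 ∣[(2 : ℤ)] diagGL ℝ N hN = fun τ => E2 (diagGL ℝ N hN • τ) * N := by
    ext τ
    rw [ModularForm.slash_apply, hσ, hdetA]
    simp [denom, diagGL, Matrix.GeneralLinearGroup.mkOfDetNeZero]
  rw [h2]
  simpa using h.mul_const (N : ℂ)

end StrongUnit

end

/-! ### Divisibility by a strong modular unit. -/

noncomputable section

namespace StrongUnit

open Filter Topology Matrix.SpecialLinearGroup Complex
open scoped ModularForm Manifold Real Pointwise

variable {N : ℕ} {w w' : ℤ} {f g : ℍ → ℂ}

lemma one_mem_strictPeriods (N : ℕ) : (1 : ℝ) ∈ (Γ₀ N).strictPeriods := by simp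

lemma analyticAt_of_mem (hf : f ∈ M N w) : AnalyticAt ℂ (cuspFunction 1 f) 0 := by
  obtain ⟨f, rfl⟩ := hf
  exact ModularFormClass.analyticAt_cuspFunction_zero f one_pos (one_mem_strictPeriods N)

lemma qExpansion_eq_zero_of_mem (hf : f ∈ M N w) : qExpansion 1 f = 0 ↔ f = 0 := by
  obtain ⟨f, rfl⟩ := hf
  rw [ModularForm.qExpansion_eq_zero_iff one_pos (one_mem_strictPeriods N)]
  exact ⟨fun h => by rw [h]; rfl, fun h => DFunLike.coe_injective h⟩

lemma ν_eq_top_iff (hf : f ∈ M N w) : ν f = ⊤ ↔ f = 0 := by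
  rw [ν, PowerSeries.order_eq_top, qExpansion_eq_zero_of_mem hf]

lemma ν_mul (hf : f ∈ M N w) (hg : g ∈ M N w') : ν (f * g) = ν f + ν g := by
  rw [ν, qExpansion_mul (analyticAt_of_mem hf) (analyticAt_of_mem hg), PowerSeries.order_mul]
  rfl

lemma mul_mem_M [NeZero N] (hf : f ∈ M N w) (hg : g ∈ M N w') : f * g ∈ M N (w + w') := by
  obtain ⟨f, rfl⟩ := hf
  obtain ⟨g, rfl⟩ := hg
  exact ⟨f.mul g, rfl⟩

lemma one_mem_M : (1 : ℍ → ℂ) ∈ M N 0 := ⟨1, rfl⟩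

lemma pow_mem_M [NeZero N] (hf : f ∈ M N w) (n : ℕ) : f ^ n ∈ M N (n * w) := by
  induction n with
  | zero => simpa using one_mem_M
  | succ n ih =>
    have := mul_mem_M ih hf
    rwa [← pow_succ, show (n : ℤ) * w + w = ((n + 1 : ℕ) : ℤ) * w by push_cast; ring] at this

lemma ν_pow_eq_zero [NeZero N] (hf : f ∈ M N w) (h : ν f = 0) (n : ℕ) : ν (f ^ n) = 0 := by
  induction n with
  | zero => rw [pow_zero, ν, qExpansion_one, PowerSeries.order_one]
  | succ n ih => rw [pow_succ, ν_mul (pow_mem_M hf n) hf, ih, h, add_zero]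

/-- A form in `M_w(Γ₀(N))` has a limit at `i∞` after slashing by any element of `SL(2, ℤ)`. -/
lemma exists_tendsto_slash [NeZero N] (hf : f ∈ M N w) (γ : SL(2, ℤ)) :
    ∃ l, Tendsto (f ∣[w] γ) atImInfty (𝓝 l) := by
  obtain ⟨f, rfl⟩ := hf
  have hcusp : IsCusp (mapGL ℝ γ • (OnePoint.infty : OnePoint ℝ)) (Γ₀ N) := by
    rw [Subgroup.IsArithmetic.isCusp_iff_isCusp_SL2Z, isCusp_SL2Z_iff']
    exact ⟨γ, rfl⟩
  have hinf := hcusp.smul (mapGL ℝ γ)⁻¹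
  rw [inv_smul_smul] at hinf
  -- The conjugate group is again arithmetic, so it has positive width at `∞` and the translated
  -- form has a `q`-expansion.
  have harith : (ConjAct.toConjAct (mapGL ℝ γ)⁻¹ • Γ₀ N).IsArithmetic := by
    have := Subgroup.IsArithmetic.conj (Γ₀ N) (mapGL ℚ γ)⁻¹
    rwa [map_inv, map_mapGL_rat] at this
  have hpos := Subgroup.strictWidthInfty_pos_iff.mpr hinf
  have hmem := Subgroup.strictWidthInfty_mem_strictPeriods
    (ConjAct.toConjAct (mapGL ℝ γ)⁻¹ • Γ₀ N)
  let F := ModularForm.translate f (mapGL ℝ γ)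
  exact ⟨_, tendsto_coeff_zero hpos (SlashInvariantFormClass.periodic_comp_ofComplex F hmem)
    (ModularFormClass.holo F) (ModularFormClass.bdd_at_infty_slash f γ)⟩

/-- If `ν Δ ≤ ν f`, then `f / Δ` is bounded at `i∞`. -/
lemma isBoundedAtImInfty_div {Δ : ℍ → ℂ} (hf : f ∈ M N w) (hΔ : Δ ∈ M N w') (hΔ0 : Δ ≠ 0)
    (h : ν Δ ≤ ν f) : IsBoundedAtImInfty (f / Δ) := by
  obtain ⟨m, hm⟩ := ENat.ne_top_iff_exists.mp (mt (ν_eq_top_iff hΔ).mp hΔ0)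
  have hcoeff {φ : ℍ → ℂ} (hφ : φ ∈ M N w ∨ φ ∈ M N w') (k : ℕ) :
      iteratedDeriv k (cuspFunction 1 φ) 0 = 0 ↔ (qExpansion 1 φ).coeff k = 0 := by
    simp [qExpansion_coeff, Nat.factorial_ne_zero]
  have hordΔ : analyticOrderAt (cuspFunction 1 Δ) 0 = m := by
    rw [analyticOrderAt_eq_nat_iff_iteratedDeriv_eq_zero (analyticAt_of_mem hΔ)]
    obtain ⟨h1, h2⟩ := PowerSeries.order_eq_nat.mp hm.symm
    exact ⟨fun k hk => (hcoeff (.inr hΔ) k).mpr (h2 k hk), fun h0 => h1 ((hcoeff (.inr hΔ) m).mp h0)⟩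
  have hordf : (m : ℕ∞) ≤ analyticOrderAt (cuspFunction 1 f) 0 := by
    rw [natCast_le_analyticOrderAt_iff_iteratedDeriv_eq_zero (analyticAt_of_mem hf)]
    intro k hk
    rw [hcoeff (.inl hf)]
    refine PowerSeries.coeff_of_lt_order k (lt_of_lt_of_le ?_ h)
    rw [← hm]
    exact_mod_cast hk
  -- Near `q = 0` the cusp functions are `q^m D` with `D 0 ≠ 0` and `q^m F`, so the quotient tends
  -- to `F 0 / D 0`.
  obtain ⟨D, hD, hD0, hDe⟩ := (analyticAt_of_mem hΔ).analyticOrderAt_eq_natCast.mp hordΔ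
  obtain ⟨F, hF, hFe⟩ := (natCast_le_analyticOrderAt (analyticAt_of_mem hf)).mp hordf
  have hlim : Tendsto (fun τ : ℍ => F (Function.Periodic.qParam 1 τ) /
      D (Function.Periodic.qParam 1 τ)) atImInfty (𝓝 (F 0 / D 0)) :=
    ((hF.continuousAt.div hD.continuousAt hD0).tendsto).comp (qParam_tendsto_atImInfty one_pos)
  have hev : (fun τ : ℍ => F (Function.Periodic.qParam 1 τ) / D (Function.Periodic.qParam 1 τ))
      =ᶠ[atImInfty] f / Δ := by
    filter_upwards [(qParam_tendsto_atImInfty one_pos).eventually hDe,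
      (qParam_tendsto_atImInfty one_pos).eventually hFe] with τ h1 h2
    obtain ⟨f, rfl⟩ := hf
    obtain ⟨Δ, rfl⟩ := hΔ
    rw [SlashInvariantFormClass.eq_cuspFunction _ _ (one_mem_strictPeriods N) one_ne_zero] at h1 h2
    have hq : Function.Periodic.qParam 1 τ ≠ 0 := Complex.exp_ne_zero _
    rw [Pi.div_apply, h1, h2, sub_zero, smul_eq_mul, smul_eq_mul,
      mul_div_mul_left _ _ (pow_ne_zero _ hq)]
  exact (hlim.congr' hev).isBigO_one ℝ

/-- A form whose valuation is at least that of a strong modular unit is divisible by it. -/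
lemma div_mem_M [NeZero N] {Δ : ℍ → ℂ} (hΔ : IsStrongModularUnit N w' Δ) (hf : f ∈ M N w)
    (h : ν Δ ≤ ν f) : f / Δ ∈ M N (w - w') := by
  have hinv {γ : SL(2, ℤ)} (hγ : γ ∈ CongruenceSubgroup.Gamma0 N) :
      (f / Δ) ∣[w - w'] γ = f / Δ := by
    obtain ⟨f, rfl⟩ := hf
    obtain ⟨Δ, rfl⟩ := hΔ.mem
    have hmem : mapGL ℝ γ ∈ Γ₀ N := ⟨γ, hγ, rfl⟩
    rw [ModularForm.div_slash_SL2, ModularForm.SL_slash, ModularForm.SL_slash]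
    exact congr_arg₂ _ (SlashInvariantFormClass.slash_action_eq f _ hmem)
      (SlashInvariantFormClass.slash_action_eq Δ _ hmem)
  refine ⟨{ toFun := f / Δ, slash_action_eq' := ?_, holo' := ?_, bdd_at_cusps' := ?_ }, rfl⟩
  · rintro _ ⟨γ, hγ, rfl⟩
    exact hinv hγ
  · obtain ⟨f, rfl⟩ := hf
    obtain ⟨D, rfl⟩ := hΔ.mem
    have h1 := UpperHalfPlane.mdifferentiable_iff.mp (ModularFormClass.holo f)
    have h2 := UpperHalfPlane.mdifferentiable_iff.mp (ModularFormClass.holo D)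
    exact UpperHalfPlane.mdifferentiable_iff.mpr (h1.div h2 fun z _ => hΔ.ne_zero _)
  · intro c hc
    have hΔ0 : Δ ≠ 0 := fun h0 => hΔ.ne_zero I (by rw [h0]; rfl)
    by_cases horb : c ∈ MulAction.orbit (Γ₀ N) (OnePoint.infty : OnePoint ℝ)
    · obtain ⟨⟨_, γ, hγ, rfl⟩, rfl⟩ := horb
      change OnePoint.IsBoundedAt (mapGL ℝ γ • OnePoint.infty) _ _
      rw [OnePoint.isBoundedAt_iff rfl]
      change IsBoundedAtImInfty ((f / Δ) ∣[w - w'] γ)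
      rw [hinv hγ]
      exact isBoundedAtImInfty_div hf hΔ.mem hΔ0 h
    -- Away from the orbit of `∞`, `Δ` slashed has a nonzero limit, so the quotient converges too.
    · have hz := hΔ.not_isZeroAt c hc horb
      rw [Subgroup.IsArithmetic.isCusp_iff_isCusp_SL2Z] at hc
      rw [OnePoint.isBoundedAt_iff_forall_SL2Z hc]
      intro γ hγ
      rw [ModularForm.div_slash_SL2]
      obtain ⟨l, hl⟩ := exists_tendsto_slash hf γ
      obtain ⟨l', hl'⟩ := exists_tendsto_slash hΔ.mem γ
      have hl0 : l' ≠ 0 := by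
        rintro rfl
        exact hz ((OnePoint.isZeroAt_iff hγ).mpr hl')
      exact (hl.div hl' hl0).isBigO_one ℝ

lemma exists_smul_of_ν_le [NeZero N] {Δ : ℍ → ℂ} (hΔ : IsStrongModularUnit N w Δ) (hf : f ∈ M N w)
    (h : ν Δ ≤ ν f) : ∃ c : ℂ, f = c • Δ := by
  have := div_mem_M hΔ hf h
  rw [sub_self] at this
  obtain ⟨g, hg⟩ := this
  obtain ⟨c, hc⟩ := ModularForm.eq_const_of_weight_zero g
  refine ⟨c, ?_⟩
  ext τ
  have := congr_fun (hg.symm.trans hc) τ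
  rwa [Pi.div_apply, Function.const_apply, div_eq_iff (hΔ.ne_zero τ)] at this

/-- A form of larger valuation would be a nonzero multiple of `Δ`, hence have the valuation of `Δ`.
-/
lemma ν_le_of_mem [NeZero N] {Δ : ℍ → ℂ} (hΔ : IsStrongModularUnit N w Δ) (hf : f ∈ M N w)
    (hf0 : f ≠ 0) : ν f ≤ ν Δ := by
  by_contra! hlt
  obtain ⟨c, rfl⟩ := exists_smul_of_ν_le hΔ hf hlt.le
  have hc : c ≠ 0 := by
    rintro rfl
    exact hf0 (zero_smul _ _)
  rw [ν, ν, qExpansion_smul (analyticAt_of_mem hΔ.mem)] at hlt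
  obtain ⟨m, hm⟩ := ENat.ne_top_iff_exists.mp hlt.ne_top
  have h1 := (PowerSeries.order_eq_nat.mp hm.symm).1
  have h2 := PowerSeries.coeff_of_lt_order m (hm.symm ▸ hlt)
  rw [PowerSeries.coeff_smul, smul_eq_zero] at h2
  exact h2.elim hc h1

end StrongUnit

end

/-! ### Triangular bases, the one-step splitting and its iteration. -/

noncomputable section

namespace StrongUnit

variable {N : ℕ} {w : ℤ}

/-- The `q`-expansion as a linear map on `M_w(Γ₀(N))`. -/
def qExpansionLinearMap (N : ℕ) (w : ℤ) : M N w →ₗ[ℂ] PowerSeries ℂ where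
  toFun f := qExpansion 1 (f : ℍ → ℂ)
  map_add' f g := qExpansion_add (analyticAt_of_mem f.2) (analyticAt_of_mem g.2)
  map_smul' c f := qExpansion_smul (analyticAt_of_mem f.2) c

/-- Vectors whose power series have orders `0, 1, …, m - 1` allow to adjust the first `m`
coefficients in exactly one way. -/
lemma existsUnique_sub_order_ge {V : Type*} [AddCommGroup V] [Module ℂ V]
    (Φ : V →ₗ[ℂ] PowerSeries ℂ) {m : ℕ} (e : Fin m → V)
    (he : ∀ s, (Φ (e s)).order = ((s : ℕ) : ℕ∞)) (f : V) :
    ∃! c : Fin m → ℂ, (m : ℕ∞) ≤ (Φ (f - ∑ s, c s • e s)).order := by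
  let A : Matrix (Fin m) (Fin m) ℂ := .of fun s j => (Φ (e s)).coeff j
  have hA : IsUnit A.det := by
    have htri : A.BlockTriangular id := fun s j hjs => by
      refine PowerSeries.coeff_of_lt_order _ (lt_of_lt_of_eq ?_ (he s).symm)
      exact_mod_cast hjs
    rw [Matrix.det_of_isUpperTriangular htri, isUnit_iff_ne_zero, Finset.prod_ne_zero_iff]
    exact fun s _ => (PowerSeries.order_eq_nat.mp (he s)).1
  have key (c : Fin m → ℂ) : (m : ℕ∞) ≤ (Φ (f - ∑ s, c s • e s)).order ↔
      Matrix.vecMul c A = fun j : Fin m => (Φ f).coeff j := by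
    rw [funext_iff]
    have hcoeff (j : Fin m) : (Φ (f - ∑ s, c s • e s)).coeff (j : ℕ) =
        (Φ f).coeff (j : ℕ) - Matrix.vecMul c A j := by
      simp [Matrix.vecMul, dotProduct, A]
    constructor
    · intro h j
      have := PowerSeries.coeff_of_lt_order (j : ℕ) (lt_of_lt_of_le (by exact_mod_cast j.2) h)
      rw [hcoeff, sub_eq_zero] at this
      exact this.symm
    · intro h
      refine PowerSeries.nat_le_order _ _ fun j hj => ?_
      have := hcoeff ⟨j, hj⟩
      rw [h, sub_self] at this
      exact this
  refine ⟨Matrix.vecMul (fun j : Fin m => (Φ f).coeff j) A⁻¹, ?_, fun c hc => ?_⟩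
  · exact (key _).mpr (by rw [Matrix.vecMul_vecMul, Matrix.nonsing_inv_mul _ hA, Matrix.vecMul_one])
  · rw [← (key c).mp hc, Matrix.vecMul_vecMul, Matrix.mul_nonsing_inv _ hA, Matrix.vecMul_one]

lemma IsUnitaryTriangularBasis.mem {E : ℕ → ℍ → ℂ} (hE : IsUnitaryTriangularBasis N w E) {s : ℕ}
    (hs : s < d N w) : E s ∈ M N w := by
  rw [← hE.span_eq]
  exact Submodule.subset_span ⟨s, hs, rfl⟩

/-- The valuations of a unitary upper triangular basis grow at least by one at each step. -/
lemma IsUnitaryTriangularBasis.ν_add_le {E : ℕ → ℍ → ℂ} (hE : IsUnitaryTriangularBasis N w E)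
    (s t : ℕ) (hst : s + t < d N w) : ν (E s) + t ≤ ν (E (s + t)) := by
  induction t with
  | zero => simp
  | succ t ih =>
    have h1 := ih (by omega)
    have h2 := Order.add_one_le_of_lt (hE.ν_lt (s + t) (s + (t + 1)) (by omega) hst)
    calc ν (E s) + ((t + 1 : ℕ) : ℕ∞) = ν (E s) + t + 1 := by push_cast; rw [add_assoc]
      _ ≤ ν (E (s + t)) + 1 := by gcongr
      _ ≤ _ := h2

/-- In weight `ρ`, the valuations of an upper triangular basis are `0, 1, …, ν(Δ)`. -/
lemma IsUnitaryTriangularBasis.ν_eq [NeZero N] {Δ : ℍ → ℂ} (hΔ : IsStrongModularUnit N w Δ)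
    {m : ℕ} (hm : ν Δ = m) (hd : d N w = m + 1) {E : ℕ → ℍ → ℂ}
    (hE : IsUnitaryTriangularBasis N w E) {s : ℕ} (hs : s ≤ m) : ν (E s) = s := by
  -- Climbing from index `0` to `s` gives `s ≤ ν (E s)`; climbing from `s` to `m`, where `ν (E m) ≤
  -- m`, gives the reverse.
  have h0 := hE.ν_add_le 0 s (by omega)
  have h1 := hE.ν_add_le s (m - s) (by omega)
  have hmem : E m ∈ M N w := hE.mem (by omega)
  have h2 : ν (E m) ≤ m :=
    hm ▸ ν_le_of_mem hΔ hmem (hE.linearIndepOn.ne_zero (by simp [hd]))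
  rw [zero_add] at h0
  rw [Nat.add_sub_cancel' hs] at h1
  have h3 := h1.trans h2
  obtain ⟨a, ha⟩ := ENat.ne_top_iff_exists.mp
    (ne_top_of_le_ne_top (ENat.natCast_ne_top m) (le_self_add.trans h3))
  rw [← ha] at h0 h3 ⊢
  have h4 : s ≤ a := by exact_mod_cast le_add_self.trans h0
  have h5 : a + (m - s) ≤ m := by exact_mod_cast h3
  exact_mod_cast (by omega : a = s)

/-- The first element of an upper triangular basis in weight `2` does not vanish at `i∞`. -/
lemma IsUnitaryTriangularBasis.zero_weight_two (hN : 2 ≤ N) {E : ℕ → ℍ → ℂ}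
    (hE : IsUnitaryTriangularBasis N 2 E) : E 0 ∈ M N 2 ∧ ν (E 0) = 0 := by
  have : NeZero N := ⟨by omega⟩
  have hN0 : (N : ℝ) ≠ 0 := by exact_mod_cast this.ne
  have hmem := eisTwo_mem N hN0
  have hcoeff : (qExpansion 1 (eisTwo N hN0)).coeff 0 ≠ 0 := by
    obtain ⟨G, hG⟩ := hmem
    have h1 := tendsto_coeff_zero one_pos
      (SlashInvariantFormClass.periodic_comp_ofComplex G (one_mem_strictPeriods N))
      (ModularFormClass.holo G) (ModularFormClass.bdd_at_infty G)
    rw [hG] at h1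
    rw [tendsto_nhds_unique h1 (tendsto_eisTwo N hN0), sub_ne_zero]
    exact_mod_cast (by omega : N ≠ 1)
  by_cases hd : 0 < d N 2 ∧ ν (E 0) = 0
  · exact ⟨hE.mem hd.1, hd.2⟩
  · exfalso
    let L : M N 2 →ₗ[ℂ] ℂ := PowerSeries.coeff 0 ∘ₗ qExpansionLinearMap N 2
    -- Otherwise the basis is empty or all its members vanish at `∞`, so every form of weight 2
    -- would, against `eisTwo`.
    have hle : M N 2 ≤ L.ker.map (M N 2).subtype := by
      conv_lhs => rw [← hE.span_eq]
      rw [Submodule.span_le]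
      rintro _ ⟨s, hs, rfl⟩
      refine ⟨⟨E s, hE.mem hs⟩, ?_, rfl⟩
      have hs' : s < d N 2 := hs
      have hν : ν (E 0) ≤ ν (E s) := le_self_add.trans
        (by simpa using hE.ν_add_le 0 s (by omega))
      have hpos : ((0 : ℕ) : ℕ∞) < ν (E s) :=
        lt_of_lt_of_le (pos_iff_ne_zero.mpr fun h0 => hd ⟨by omega, h0⟩) hν
      have hz : (qExpansion 1 (E s)).coeff 0 = 0 := PowerSeries.coeff_of_lt_order 0 hpos
      exact hz
    obtain ⟨G, hG, hGe⟩ := hle hmem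
    rw [← hGe] at hcoeff
    exact hcoeff hG

lemma mulSpace_mul (a b : ℍ → ℂ) (W : Submodule ℂ (ℍ → ℂ)) :
    mulSpace (a * b) W = mulSpace a (mulSpace b W) := by
  rw [mulSpace, LinearMap.mulLeft_mul, Submodule.map_comp]
  rfl

/-- One step of the decomposition. -/
lemma mulSpace_sup_piece [NeZero N] {ρ : ℕ} (hρ : Even ρ) {Δ : ℍ → ℂ}
    (hΔ : IsStrongModularUnit N ρ Δ) {E : ℕ → ℍ → ℂ} {F : ℍ → ℂ}
    (hE : ∀ s : ℕ, (s : ℕ∞) < ν Δ → E s ∈ M N ρ ∧ ν (E s) = s)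
    (hF : F ∈ M N 2) (hF0 : ν F = 0) {k : ℕ} (hk : ρ / 2 ≤ k) :
    mulSpace Δ (M N (2 * (k : ℤ) - ρ)) ⊔ piece Δ E F (k - ρ / 2) = M N (2 * (k : ℤ)) ∧
      Disjoint (mulSpace Δ (M N (2 * (k : ℤ) - ρ))) (piece Δ E F (k - ρ / 2)) := by
  have hΔ0 : Δ ≠ 0 := fun h0 => hΔ.ne_zero I (by rw [h0]; rfl)
  obtain ⟨m, hm⟩ := ENat.ne_top_iff_exists.mp (mt (ν_eq_top_iff hΔ.mem).mp hΔ0)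
  have hwt : (ρ : ℤ) + ((k - ρ / 2 : ℕ) : ℤ) * 2 = 2 * k := by
    obtain ⟨r, rfl⟩ := hρ
    omega
  have hlt (s : Fin m) : ((s : ℕ) : ℕ∞) < ν Δ := by
    rw [← hm]
    exact_mod_cast s.2
  have hmem (s : Fin m) : E s * F ^ (k - ρ / 2) ∈ M N (2 * (k : ℤ)) := by
    rw [← hwt]
    exact mul_mem_M (hE s (hlt s)).1 (pow_mem_M hF _)
  let e : Fin m → M N (2 * (k : ℤ)) := fun s => ⟨E s * F ^ (k - ρ / 2), hmem s⟩
  have he (s : Fin m) : (qExpansionLinearMap N (2 * (k : ℤ)) (e s)).order = ((s : ℕ) : ℕ∞) := by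
    change ν (E s * F ^ (k - ρ / 2)) = _
    rw [ν_mul (hE s (hlt s)).1 (pow_mem_M hF _), ν_pow_eq_zero hF hF0, add_zero, (hE s (hlt s)).2]
  have hpiece : piece Δ E F (k - ρ / 2) =
      Submodule.span ℂ (Set.range fun s : Fin m => E s * F ^ (k - ρ / 2)) := by
    rw [piece]
    congr 1
    ext φ
    constructor
    · rintro ⟨s, hs, rfl⟩
      rw [Set.mem_ofPred_eq, ← hm] at hs
      exact ⟨⟨s, by exact_mod_cast hs⟩, rfl⟩
    · rintro ⟨s, rfl⟩
      exact ⟨s, hlt s, rfl⟩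
  have hcoe (c : Fin m → ℂ) : ((∑ s, c s • e s : M N (2 * (k : ℤ))) : ℍ → ℂ) =
      ∑ s, c s • (E s * F ^ (k - ρ / 2)) := by
    simp [e]
  have hle : mulSpace Δ (M N (2 * (k : ℤ) - ρ)) ≤ M N (2 * (k : ℤ)) := by
    rintro _ ⟨g, hg, rfl⟩
    have := mul_mem_M hΔ.mem hg
    rwa [add_sub_cancel] at this
  refine ⟨le_antisymm (sup_le hle ?_) fun f hf => ?_, ?_⟩
  · rw [hpiece, Submodule.span_le]
    rintro _ ⟨s, rfl⟩
    exact hmem s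
  · obtain ⟨c, hc, -⟩ := existsUnique_sub_order_ge (qExpansionLinearMap N _) e he ⟨f, hf⟩
    set p : M N (2 * (k : ℤ)) := ∑ s, c s • e s with hp
    have hdiv := div_mem_M hΔ (f := ((⟨f, hf⟩ - p : M N (2 * (k : ℤ))) : ℍ → ℂ))
      (Subtype.property _) (hm ▸ hc)
    refine Submodule.mem_sup.mpr ⟨f - p, ⟨_, hdiv, ?_⟩, p, ?_, sub_add_cancel _ _⟩
    · ext τ
      exact mul_div_cancel₀ _ (hΔ.ne_zero τ)
    · rw [hpiece, Submodule.mem_span_range_iff_exists_fun]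
      exact ⟨c, (hcoe c).symm⟩
  · rw [Submodule.disjoint_def]
    intro f hf hfp
    rw [hpiece, Submodule.mem_span_range_iff_exists_fun] at hfp
    obtain ⟨c, rfl⟩ := hfp
    obtain ⟨g, hg, hgf⟩ := hf
    set p : M N (2 * (k : ℤ)) := ∑ s, c s • e s with hp
    -- For `p` in both summands, the coefficients `c` and `0` both leave a remainder of valuation at
    -- least `m`; uniqueness forces `c = 0`.
    have hc : (m : ℕ∞) ≤ (qExpansionLinearMap N (2 * (k : ℤ)) (p - ∑ s, c s • e s)).order := by
      rw [← hp, sub_self, map_zero, PowerSeries.order_zero]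
      exact le_top
    have h0 : (m : ℕ∞) ≤
        (qExpansionLinearMap N (2 * (k : ℤ)) (p - ∑ s, (0 : Fin m → ℂ) s • e s)).order := by
      have h1 : p - ∑ s, (0 : Fin m → ℂ) s • e s = p := by simp
      rw [h1, hm]
      change ν Δ ≤ ν (p : ℍ → ℂ)
      rw [hp, hcoe, ← hgf]
      change ν Δ ≤ ν (Δ * g)
      rw [ν_mul hΔ.mem hg]
      exact le_self_add
    have hc0 := (existsUnique_sub_order_ge (qExpansionLinearMap N _) e he p).unique hc h0
    simp [hc0]

/-- A chain of decompositions `W n = W (n + 1) ⊕ P n` adds up to a direct sum. -/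
lemma isInternalDirectSum_of_chain (W P : ℕ → Submodule ℂ (ℍ → ℂ)) (q : ℕ)
    (hsup : ∀ n < q, W (n + 1) ⊔ P n = W n) (hdisj : ∀ n < q, Disjoint (W (n + 1)) (P n)) :
    IsInternalDirectSum (W 0) (fun i : Option (Fin q) => i.elim (W q) fun n => P n) := by
  constructor
  -- In the induction, `x + v q` is absorbed into `W q`, and disjointness then separates `x` from `v
  -- q`.
  · have key : ∀ (v : ℕ → ℍ → ℂ) (x : ℍ → ℂ), x ∈ W q → (∀ n < q, v n ∈ P n) →
        x + ∑ n ∈ Finset.range q, v n = 0 → x = 0 ∧ ∀ n < q, v n = 0 := by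
      induction q with
      | zero => simp
      | succ q ih =>
        intro v x hx hv h0
        rw [Finset.sum_range_succ, add_comm (∑ n ∈ _, v n), ← add_assoc] at h0
        have hmem : x + v q ∈ W q := by
          rw [← hsup q (Nat.lt_succ_self q)]
          exact Submodule.add_mem_sup hx (hv q (Nat.lt_succ_self q))
        obtain ⟨h1, h2⟩ := ih (fun n hn => hsup n (by omega)) (fun n hn => hdisj n (by omega)) v _
          hmem (fun n hn => hv n (by omega)) h0
        have hx0 : x = 0 := Submodule.disjoint_def.mp (hdisj q (Nat.lt_succ_self q)) x hx
          (by rw [eq_neg_of_add_eq_zero_left h1]; exact neg_mem (hv q (Nat.lt_succ_self q)))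
        refine ⟨hx0, fun n hn => ?_⟩
        rcases Nat.lt_succ_iff_lt_or_eq.mp hn with hn | rfl
        · exact h2 n hn
        · rwa [hx0, zero_add] at h1
    classical
    rw [iSupIndep_iff_finsetSum_eq_zero_imp_eq_zero]
    intro s v hv h0
    let u : Option (Fin q) → ℍ → ℂ := fun i => if i ∈ s then v i else 0
    have hu (i) : u i ∈ (i.elim (W q) fun n => P n : Submodule ℂ (ℍ → ℂ)) := by
      by_cases hi : i ∈ s
      · simpa [u, hi] using hv i hi
      · simp [u, hi]
    have hu0 : ∑ i, u i = 0 := by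
      simpa [u, Finset.sum_ite_mem] using h0
    rw [Fintype.sum_option] at hu0
    let y : ℕ → ℍ → ℂ := fun n => if hn : n < q then u (some ⟨n, hn⟩) else 0
    have hy : ∑ n ∈ Finset.range q, y n = ∑ n : Fin q, u (some n) := by
      rw [Finset.sum_range]
      exact Finset.sum_congr rfl fun n _ => by simp [y]
    rw [← hy] at hu0
    obtain ⟨h1, h2⟩ := key y (u none) (hu none)
      (fun n hn => by simpa [y, hn] using hu (some ⟨n, hn⟩)) hu0
    intro i hi
    have hui : u i = v i := if_pos hi
    rw [← hui]
    cases i with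
    | none => exact h1
    | some n => simpa [y] using h2 n n.2
  · have key : W q ⊔ ⨆ n < q, P n = W 0 := by
      induction q with
      | zero => simp
      | succ q ih =>
        rw [← ih (fun n hn => hsup n (by omega)) (fun n hn => hdisj n (by omega)),
          ← hsup q (Nat.lt_succ_self q), Nat.iSup_lt_succ, sup_assoc, sup_comm (P q)]
    rw [iSup_option, ← key]
    congr 1
    exact le_antisymm (iSup_le fun n => le_iSup₂_of_le (n : ℕ) n.2 le_rfl)
      (iSup₂_le fun n hn => le_iSup_of_le (⟨n, hn⟩ : Fin q) le_rfl)

end StrongUnit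

end

theorem mainTheorem2 (N : ℕ) (hN : 2 ≤ N) (ρ : ℕ) (hρ : 0 < ρ) (hρ_even : Even ρ)
    (Δ : ℍ → ℂ) (hΔ : StrongUnit.IsStrongModularUnit N ρ Δ)
    (hdim : (StrongUnit.d N ρ : ℕ∞) = StrongUnit.ν Δ + 1)
    -- unitary upper triangular bases of the spaces of weights `ρ` and `2`
    (Eρ : ℕ → ℍ → ℂ) (hEρ : StrongUnit.IsUnitaryTriangularBasis N ρ Eρ)
    (E₂ : ℕ → ℍ → ℂ) (hE₂ : StrongUnit.IsUnitaryTriangularBasis N 2 E₂) :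
    (∀ k : ℕ, ρ / 2 ≤ k →
      StrongUnit.mulSpace Δ (StrongUnit.M N (2 * (k : ℤ) - (ρ : ℤ))) ⊔
          StrongUnit.piece Δ Eρ (E₂ 0) (k - ρ / 2) = StrongUnit.M N (2 * (k : ℤ)) ∧
        Disjoint (StrongUnit.mulSpace Δ (StrongUnit.M N (2 * (k : ℤ) - (ρ : ℤ))))
          (StrongUnit.piece Δ Eρ (E₂ 0) (k - ρ / 2))) ∧
    (∀ k q r : ℕ, k = q * (ρ / 2) + r → 1 ≤ r → r ≤ ρ / 2 →
      StrongUnit.IsInternalDirectSum (StrongUnit.M N (2 * (k : ℤ)))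
        (fun i : Option (Fin q) => i.elim
          (StrongUnit.mulSpace (Δ ^ q) (StrongUnit.M N (2 * (r : ℤ))))
          (fun n => StrongUnit.mulSpace (Δ ^ (n : ℕ))
            (StrongUnit.piece Δ Eρ (E₂ 0) (k - ((n : ℕ) + 1) * (ρ / 2)))))) := by
  have : NeZero N := ⟨by omega⟩
  obtain ⟨hF, hF0⟩ := hE₂.zero_weight_two hN
  have hE (s : ℕ) (hs : (s : ℕ∞) < StrongUnit.ν Δ) :
      Eρ s ∈ StrongUnit.M N ρ ∧ StrongUnit.ν (Eρ s) = s := by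
    have htop : StrongUnit.ν Δ ≠ ⊤ := fun h => by
      rw [h, top_add] at hdim
      exact ENat.natCast_ne_top _ hdim
    obtain ⟨m, hm⟩ := ENat.ne_top_iff_exists.mp htop
    rw [← hm] at hdim hs
    have hd : StrongUnit.d N ρ = m + 1 := by exact_mod_cast hdim
    have hsm : s < m := by exact_mod_cast hs
    exact ⟨hEρ.mem (by omega), hEρ.ν_eq hΔ hm.symm hd hsm.le⟩
  have step (k : ℕ) (hk : ρ / 2 ≤ k) :=
    StrongUnit.mulSpace_sup_piece hρ_even hΔ hE hF hF0 hk
  refine ⟨step, ?_⟩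
  rintro k q r hkq - -
  -- The one-step splitting in weight `2k - nρ`; multiplied by `Δ ^ n` it is the `n`-th link of the
  -- chain.
  have hstep (n : ℕ) (hn : n < q) :
      StrongUnit.M N (2 * (k : ℤ) - n * ρ) =
          StrongUnit.mulSpace Δ (StrongUnit.M N (2 * (k : ℤ) - (n + 1 : ℕ) * ρ)) ⊔
            StrongUnit.piece Δ Eρ (E₂ 0) (k - (n + 1) * (ρ / 2)) ∧
        Disjoint (StrongUnit.mulSpace Δ (StrongUnit.M N (2 * (k : ℤ) - (n + 1 : ℕ) * ρ)))
          (StrongUnit.piece Δ Eρ (E₂ 0) (k - (n + 1) * (ρ / 2))) := by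
    obtain ⟨ρ', rfl⟩ := hρ_even
    rw [← two_mul, Nat.mul_div_cancel_left _ two_pos] at *
    have hle : (n + 1) * ρ' ≤ k := by
      rw [hkq]
      exact (Nat.mul_le_mul_right _ hn).trans (Nat.le_add_right _ _)
    obtain ⟨k', rfl⟩ := Nat.exists_eq_add_of_le hle
    have h := step (ρ' + k') (Nat.le_add_right _ _)
    rw [Nat.add_sub_cancel_left] at h ⊢
    have e1 : 2 * (((n + 1) * ρ' + k' : ℕ) : ℤ) - n * (2 * ρ' : ℕ) = 2 * ((ρ' + k' : ℕ) : ℤ) := by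
      push_cast; ring
    have e2 : 2 * (((n + 1) * ρ' + k' : ℕ) : ℤ) - (n + 1 : ℕ) * (2 * ρ' : ℕ) =
        2 * ((ρ' + k' : ℕ) : ℤ) - (2 * ρ' : ℕ) := by
      push_cast; ring
    rw [e1, e2]
    exact ⟨h.1.symm, h.2⟩
  have hinj (n : ℕ) : Function.Injective (LinearMap.mulLeft ℂ (Δ ^ n)) := fun a b hab => by
    ext τ
    exact mul_left_cancel₀ (pow_ne_zero n (hΔ.ne_zero τ)) (congr_fun hab τ)
  have hchain := StrongUnit.isInternalDirectSum_of_chain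
    (fun n => StrongUnit.mulSpace (Δ ^ n) (StrongUnit.M N (2 * (k : ℤ) - n * ρ)))
    (fun n => StrongUnit.mulSpace (Δ ^ n)
      (StrongUnit.piece Δ Eρ (E₂ 0) (k - (n + 1) * (ρ / 2)))) q
    (fun n hn => by
      rw [(hstep n hn).1, pow_succ, StrongUnit.mulSpace_mul]
      exact (Submodule.map_sup _ _ _).symm)
    (fun n hn => by
      rw [pow_succ, StrongUnit.mulSpace_mul]
      exact Submodule.disjoint_map (hinj n) (hstep n hn).2)
  have hr : 2 * (k : ℤ) - q * ρ = 2 * r := by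
    obtain ⟨ρ', rfl⟩ := hρ_even
    rw [← two_mul, Nat.mul_div_cancel_left _ two_pos] at hkq
    rw [hkq]
    push_cast
    ring
  have h0 : StrongUnit.mulSpace (Δ ^ 0) (StrongUnit.M N (2 * (k : ℤ) - (0 : ℕ) * ρ)) =
      StrongUnit.M N (2 * (k : ℤ)) := by
    simp [StrongUnit.mulSpace]
  rw [h0, hr] at hchain
  exact hchain
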